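/- Let $H$ be a hereditary Artin algebra, let $R$ be a local Artin algebra over the same commutative artinian ring $k$ and assume that $R$ is not a skew field. Let ${}_RM_H$ be an $R$-$H$-bimodule on which $k$ acts centrally and which is finitely generated over $k$, and let $A=\begin{pmatrix} H & 0\\ M & R\end{pmatrix}$ be the corresponding triangular matrix algebra (a local extension of $H$). Let $mod_A$ be the category of finitely generated right $A$-modules and $ind_A$ its full subcategory of indecomposable modules. A predecessor of $Y\in ind_A$ is a module $X\in ind_A$ for which there is a finite sequence $X=X_0\to X_1\to\cdots\to X_t=Y$ of non-zero morphisms between indecomposable $A$-modules. Let $\mathcal{L}_A$ be the full subcategory of $ind_A$ consisting of the modules all of whose predecessors have projective dimension at most one, and let $add(\mathcal{L}_A)$ be the full subcategory of $mod_A$ of direct summands of finite direct sums of modules in $\mathcal{L}_A$. Identify $mod_H$ with the full subcategory of $mod_A$ of the modules $X$ on which a matrix $\begin{pmatrix} h & 0\\ m & r\end{pmatrix}$ acts as $h$. All subcategories are taken closed under isomorphism. Then the following are equivalent: 1. $add(\mathcal{L}_A)$ is an abelian exact subcategory of $mod_A$, that is, it is abelian as a category and the inclusion functor $add(\mathcal{L}_A)\hookrightarrow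 mod_A$ is exact; 2. $\mathcal{L}_A=ind_H$; 3. the right $H$-module $M_H$ is injective. -/

import Mathlib

open CategoryTheory

universe u

/-- The triangular matrix ring `[[H, 0], [M, R]]` of an `R`-`H`-bimodule `M` (a left `R`-module and
a right `H`-module with commuting actions). The matrix `[[h, 0], [m, r]]` is written `⟨h, m, r⟩`. -/
@[ext]
structure TriMatrix (H M R : Type u) where
  /-- the entry in the upper left corner -/
  h : H
  /-- the entry in the lower left corner -/
  m : M
  /-- the entry in the lower right corner -/
  r : R

namespace TriMatrix

variable {H M R : Type u} [Ring H] [Ring R] [AddCommGroup M]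

instance : Zero (TriMatrix H M R) := ⟨⟨0, 0, 0⟩⟩
instance : One (TriMatrix H M R) := ⟨⟨1, 0, 1⟩⟩
instance : Add (TriMatrix H M R) := ⟨fun a b => ⟨a.h + b.h, a.m + b.m, a.r + b.r⟩⟩
instance : Neg (TriMatrix H M R) := ⟨fun a => ⟨-a.h, -a.m, -a.r⟩⟩

@[simp] theorem zero_h : (0 : TriMatrix H M R).h = 0 := rfl
@[simp] theorem zero_m : (0 : TriMatrix H M R).m = 0 := rfl
@[simp] theorem zero_r : (0 : TriMatrix H M R).r = 0 := rfl
@[simp] theorem one_h : (1 : TriMatrix H M R).h = 1 := rfl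
@[simp] theorem one_m : (1 : TriMatrix H M R).m = 0 := rfl
@[simp] theorem one_r : (1 : TriMatrix H M R).r = 1 := rfl
@[simp] theorem add_h (a b : TriMatrix H M R) : (a + b).h = a.h + b.h := rfl
@[simp] theorem add_m (a b : TriMatrix H M R) : (a + b).m = a.m + b.m := rfl
@[simp] theorem add_r (a b : TriMatrix H M R) : (a + b).r = a.r + b.r := rfl
@[simp] theorem neg_h (a : TriMatrix H M R) : (-a).h = -a.h := rfl
@[simp] theorem neg_m (a : TriMatrix H M R) : (-a).m = -a.m := rfl
@[simp] theorem neg_r (a : TriMatrix H M R) : (-a).r = -a.r := rfl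

variable [Module R M] [Module Hᵐᵒᵖ M]

/-- Matrix multiplication
`[[h, 0], [m, r]] * [[h', 0], [m', r']] = [[h h', 0], [m h' + r m', r r']]`. -/
instance : Mul (TriMatrix H M R) :=
  ⟨fun a b => ⟨a.h * b.h, MulOpposite.op b.h • a.m + a.r • b.m, a.r * b.r⟩⟩

@[simp] theorem mul_h (a b : TriMatrix H M R) : (a * b).h = a.h * b.h := rfl
@[simp] theorem mul_m (a b : TriMatrix H M R) :
    (a * b).m = MulOpposite.op b.h • a.m + a.r • b.m := rfl
@[simp] theorem mul_r (a b : TriMatrix H M R) : (a * b).r = a.r * b.r := rfl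

instance [SMulCommClass R Hᵐᵒᵖ M] : Ring (TriMatrix H M R) where
  add_assoc a b c := by ext <;> simp [add_assoc]
  zero_add a := by ext <;> simp
  add_zero a := by ext <;> simp
  add_comm a b := by ext <;> simp [add_comm]
  neg_add_cancel a := by ext <;> simp
  nsmul := nsmulRec
  zsmul := zsmulRec
  zero_mul a := by ext <;> simp
  mul_zero a := by ext <;> simp
  one_mul a := by ext <;> simp
  mul_one a := by ext <;> simp
  mul_assoc a b c := by
    ext
    · simp [mul_assoc]
    · simp [mul_smul, smul_add, smul_comm, add_assoc]
    · simp [mul_assoc]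
  left_distrib a b c := by
    ext
    · simp [mul_add]
    · simp only [mul_m, add_h, add_m, MulOpposite.op_add, add_smul, smul_add]; abel
    · simp [mul_add]
  right_distrib a b c := by
    ext
    · simp [add_mul]
    · simp only [mul_m, add_m, add_r, add_smul, smul_add]; abel
    · simp [add_mul]

/-- The surjective ring homomorphism `[[h, 0], [m, r]] ↦ h`. -/
def toH [SMulCommClass R Hᵐᵒᵖ M] : TriMatrix H M R →+* H where
  toFun a := a.h
  map_one' := rfl
  map_mul' _ _ := rfl
  map_zero' := rfl
  map_add' _ _ := rfl

theorem toH_surjective [SMulCommClass R Hᵐᵒᵖ M] :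
    Function.Surjective (toH : TriMatrix H M R →+* H) :=
  fun h => ⟨⟨h, 0, 0⟩, rfl⟩

end TriMatrix

/-- The category `mod_A` of finitely generated right `A`-modules. -/
abbrev RightMod (A : Type u) [Ring A] := FGModuleCat.{u} Aᵐᵒᵖ

/-- For a surjective ring homomorphism `f : A → B`, the functor `mod_B → mod_A` restricting
scalars along `f`. -/
noncomputable def RightMod.restrict {A B : Type u} [Ring A] [Ring B] (f : A →+* B)
    (hf : Function.Surjective f) : RightMod B ⥤ RightMod A :=
  ObjectProperty.lift _ ((ModuleCat.isFG Bᵐᵒᵖ).ι ⋙ ModuleCat.restrictScalars f.op) (by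
    intro Y
    obtain ⟨s, hs⟩ := (Module.finite_def (R := Bᵐᵒᵖ) (M := Y)).1 inferInstance
    refine (Module.finite_def (R := Aᵐᵒᵖ)
      (M := (ModuleCat.restrictScalars f.op).obj Y.obj)).2
      ⟨(show Finset ((ModuleCat.restrictScalars f.op).obj Y.obj) from s), ?_⟩
    refine (Submodule.eq_top_iff'
      (p := Submodule.span Aᵐᵒᵖ (show Set ((ModuleCat.restrictScalars f.op).obj Y.obj) from (s : Set Y)))).2 ?_
    intro x
    have hx : (show Y from x) ∈ Submodule.span Bᵐᵒᵖ (s : Set Y) := hs ▸ Submodule.mem_top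
    refine Submodule.span_induction
      (p := fun y _ => (show (ModuleCat.restrictScalars f.op).obj Y.obj from y) ∈
        Submodule.span Aᵐᵒᵖ (show Set ((ModuleCat.restrictScalars f.op).obj Y.obj) from (s : Set Y)))
      (fun y hy => Submodule.subset_span hy) (Submodule.zero_mem _)
      (fun y z _ _ hy hz => Submodule.add_mem _ hy hz) ?_ hx
    intro b y _ hy
    obtain ⟨a, ha⟩ := hf b.unop
    have h := Submodule.smul_mem _ (MulOpposite.op a) hy
    have hb : b = f.op (MulOpposite.op a) := by
      apply MulOpposite.unop_injective
      simpa using ha.symm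
    rw [hb]
    exact h)

section

variable {A : Type u} [Ring A]

/-- `X` is indecomposable: it is nonzero and has no nontrivial direct sum decomposition. The full
subcategory `ind_A` of `mod_A` is taken closed under isomorphism. -/
def IsIndec : ObjectProperty (RightMod A) := fun X =>
  Nontrivial X ∧ ∀ p q : Submodule Aᵐᵒᵖ X, IsCompl p q → p = ⊥ ∨ q = ⊥

/-- `X` is a predecessor of `Y`: there is a path `X = X₀ → X₁ → ⋯ → X_t = Y` of nonzero morphisms
between indecomposable modules. -/
def IsPredecessor : RightMod A → RightMod A → Prop :=
  Relation.TransGen fun X Y => IsIndec X ∧ IsIndec Y ∧ ∃ f : X ⟶ Y, f ≠ 0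

/-- The left part of `mod_A`: the indecomposable modules all of whose predecessors have projective
dimension at most one. -/
def leftPart (A : Type u) [Ring A] : ObjectProperty (RightMod A) := fun X =>
  IsIndec X ∧ ∀ Y : RightMod A, IsPredecessor Y X → HasProjectiveDimensionLE Y.obj 1

/-- `add(𝒞)`: the direct summands of finite direct sums of modules in `𝒞`. -/
def addClosure (C : ObjectProperty (RightMod A)) : ObjectProperty (RightMod A) := fun X =>
  ∃ (n : ℕ) (Y : Fin n → RightMod A), (∀ i, C (Y i)) ∧
    ∃ Z : RightMod A, Nonempty ((X × Z) ≃ₗ[Aᵐᵒᵖ] (∀ i, Y i))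

/-- The full subcategory `C` of `mod_A` is an abelian exact subcategory: it is abelian as a category
and the inclusion functor into `mod_A` is exact. -/
def IsAbelianExact (C : ObjectProperty (RightMod A)) : Prop :=
  Nonempty (Abelian C.FullSubcategory) ∧ exactFunctor C.FullSubcategory (RightMod A) C.ι

end

/-- `H` is hereditary: every right ideal is projective. -/
def IsHereditary (H : Type u) [Ring H] : Prop :=
  ∀ I : Submodule Hᵐᵒᵖ H, Module.Projective Hᵐᵒᵖ I

/-- `ind_H` as a full subcategory of `mod_A` for `A = [[H, 0], [M, R]]`: the image of the
indecomposable right `H`-modules `X` under the identification of `X` with the `A`-module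
`(X, 0, 0)`, on which the matrix `[[h, 0], [m, r]]` acts as `h`. -/
def indH (H M R : Type u) [Ring H] [Ring R] [AddCommGroup M] [Module R M] [Module Hᵐᵒᵖ M]
    [SMulCommClass R Hᵐᵒᵖ M] : ObjectProperty (RightMod (TriMatrix H M R)) :=
  ObjectProperty.map IsIndec (RightMod.restrict TriMatrix.toH TriMatrix.toH_surjective)

/-! Write `e` for `eR`. An `A`-module `X` comes from `mod_H` exactly when the submodule `XeA`
(`rPart`) vanishes, and the proof measures everything by this submodule.

The left part always lies in `ind_H`. Let `r` be a nonzero nonunit of `R` and `P = eA`, the row `(M,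
R)`. If `X` is indecomposable with `Xe ≠ 0`, then `rP ⊆ P → X` makes the indecomposable module `rP`
a predecessor of `X`, and the kernel of `P → rP` is not projective (`not_projective_ker_rowRMul`),
so `rP` has projective dimension greater than one.

Every finitely generated `H`-module has projective dimension at most one over `A`, because `H` is a
projective `A`-module with projective submodules. Thus `L_A = ind_H` holds as soon as all
predecessors of `H`-modules are `H`-modules. The link with injectivity is `RPartSplits`: `XeA` is a
direct summand of every `X`. Then each indecomposable `X` has `XeA = 0` or `XeA = X`, and in the
second case it has no nonzero map to an `H`-module. Conversely, `L_A = ind_H` forces this dichotomy,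
hence the splitting. The splitting is equivalent to injectivity of `M_H`: `XM` is a quotient of a
power of `M`, hence injective over hereditary `H` if `M` is; in the other direction, a suitable
cyclic module encodes Baer's criterion.

If `L_A = ind_H`, its additive closure is `mod_H`. Conversely, finitely generated projective
`H`-modules always lie in `add(L_A)`, and an abelian exact subcategory contains cokernels, hence all
of `mod_H`. -/

open MulOpposite

/-! ### Hereditary modules and projective dimension one -/

section Generic

/-- A module all of whose submodules are projective. -/
def IsHereditaryModule (S X : Type*) [Ring S] [AddCommGroup X] [Module S X] : Prop :=
  ∀ N : Submodule S X, Module.Projective S N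

namespace IsHereditaryModule

variable {S X Y Z : Type*} [Ring S] [AddCommGroup X] [Module S X] [AddCommGroup Y] [Module S Y]
  [AddCommGroup Z] [Module S Z]

theorem of_injective (hX : IsHereditaryModule S X) (f : Y →ₗ[S] X) (hf : Function.Injective f) :
    IsHereditaryModule S Y := fun N =>
  have := hX (N.map f)
  Module.Projective.of_equiv (Submodule.equivMapOfInjective f hf N).symm

theorem projective (hX : IsHereditaryModule S X) : Module.Projective S X :=
  have := hX ⊤
  Module.Projective.of_equiv (Submodule.topEquiv (R := S) (M := X))

/-- For `N ≤ X` the image of `N` in `Z` is projective, so `N` splits as that image plus a submodule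
of `ker f`. -/
theorem of_ker (f : X →ₗ[S] Z) (hZ : IsHereditaryModule S Z)
    (hK : IsHereditaryModule S (LinearMap.ker f)) : IsHereditaryModule S X := by
  intro N
  let g : N →ₗ[S] Z := f ∘ₗ N.subtype
  have := hZ (LinearMap.range g)
  obtain ⟨s, hs⟩ := Module.projective_lifting_property g.rangeRestrict LinearMap.id
    g.surjective_rangeRestrict
  have hs' : ∀ y, g (s y) = y := fun y => congrArg Subtype.val (LinearMap.congr_fun hs y)
  have : Module.Projective S (LinearMap.ker g) := by
    let j : LinearMap.ker g →ₗ[S] LinearMap.ker f :=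
      (N.subtype ∘ₗ (LinearMap.ker g).subtype).codRestrict _ (fun x => x.2)
    refine (hK.of_injective j fun x y h => ?_).projective
    have h' : ((j x : LinearMap.ker f) : X) = (j y : LinearMap.ker f) := congrArg Subtype.val h
    exact Subtype.ext (Subtype.ext h')
  let i : N →ₗ[S] LinearMap.ker g × LinearMap.range g :=
    LinearMap.prod ((LinearMap.id - s ∘ₗ g.rangeRestrict).codRestrict _ (fun x => by
      simp [hs'])) g.rangeRestrict
  refine Module.Projective.of_split i (LinearMap.coprod (LinearMap.ker g).subtype s) ?_
  ext x
  simp [i]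

theorem pi_fin (hX : IsHereditaryModule S X) (n : ℕ) : IsHereditaryModule S (Fin n → X) := by
  induction n with
  | zero =>
    intro N
    infer_instance
  | succ n ih =>
    refine of_ker (LinearMap.proj 0) hX ?_
    refine ih.of_injective
      (LinearMap.pi (fun i => LinearMap.proj i.succ) ∘ₗ (LinearMap.ker _).subtype) ?_
    intro x y h
    refine Subtype.ext (funext fun i => ?_)
    refine Fin.cases ?_ (fun i => congrFun h i) i
    have hx : (x : Fin (n + 1) → X) 0 = 0 := x.2
    have hy : (y : Fin (n + 1) → X) 0 = 0 := y.2
    rw [hx, hy]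

end IsHereditaryModule

/-- Baer's criterion: a map `I → Q'` lifts to `Q` because `I` is projective, and the lift extends to
`S` because `Q` is injective. -/
theorem Module.Injective.of_surjective_of_hereditary {S : Type u} {Q Q' : Type u} [Ring S]
    [AddCommGroup Q] [Module S Q] [AddCommGroup Q'] [Module S Q'] (hS : IsHereditaryModule S S)
    (hQ : Module.Injective S Q) (f : Q →ₗ[S] Q') (hf : Function.Surjective f) :
    Module.Injective S Q' := by
  refine Module.Baer.injective fun I g => ?_
  have := hS I
  obtain ⟨g₁, hg₁⟩ := Module.projective_lifting_property f g hf
  obtain ⟨g₂, hg₂⟩ := Module.Baer.of_injective hQ I g₁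
  refine ⟨f ∘ₗ g₂, fun x hx => ?_⟩
  rw [LinearMap.comp_apply, hg₂ x hx, ← hg₁]
  rfl

theorem hasProjectiveDimensionLE_one_iff_ker {S : Type u} [Ring S] {P X : Type u} [AddCommGroup P]
    [Module S P] [AddCommGroup X] [Module S X] [Module.Projective S P] (f : P →ₗ[S] X)
    (hf : Function.Surjective f) :
    HasProjectiveDimensionLE (ModuleCat.of S X) 1 ↔ Module.Projective S (LinearMap.ker f) := by
  let T : ShortComplex (ModuleCat.{u} S) :=
    ShortComplex.mk (ModuleCat.ofHom (LinearMap.ker f).subtype) (ModuleCat.ofHom f)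
      (by ext x; exact x.2)
  have hT : T.ShortExact :=
    { exact := (ShortComplex.moduleCat_exact_iff _).2 fun x hx => ⟨⟨x, hx⟩, rfl⟩
      mono_f := (ModuleCat.mono_iff_injective _).2 Subtype.val_injective
      epi_g := (ModuleCat.epi_iff_surjective _).2 hf }
  have hP : Projective T.X₂ := (IsProjective.iff_projective P).1 inferInstance
  rw [IsProjective.iff_projective]
  exact (hT.hasProjectiveDimensionLT_X₃_iff 0 hP).trans
    (projective_iff_hasProjectiveDimensionLT_one (X := T.X₁)).symm

end Generic

/-! ### Indecomposables, predecessors and additive closures -/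

section RightModules

variable {A : Type u} [Ring A]

theorem IsIndec.of_linearEquiv {X Y : RightMod A} (e : X ≃ₗ[Aᵐᵒᵖ] Y) (hX : IsIndec X) :
    IsIndec Y := by
  refine ⟨(Equiv.nontrivial_congr e.toEquiv).1 hX.1, fun p q h => ?_⟩
  have h' : IsCompl (p.comap e.toLinearMap) (q.comap e.toLinearMap) :=
    (Submodule.orderIsoMapComap e).symm.isCompl h
  refine (hX.2 _ _ h').imp ?_ ?_ <;>
  · intro h
    exact (map_eq_bot_iff (Submodule.orderIsoMapComap e).symm).1 h

theorem RightMod.hom_ne_zero_iff {X Y : RightMod A} (f : X ⟶ Y) :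
    f ≠ 0 ↔ ∃ x, f.hom.hom x ≠ 0 := by
  rw [← not_iff_not]
  push Not
  exact ⟨fun h x => by rw [h]; rfl, fun h => by ext x; exact h x⟩

theorem IsPredecessor.of_linearMap {X Y : RightMod A} (hX : IsIndec X) (hY : IsIndec Y)
    (f : X →ₗ[Aᵐᵒᵖ] Y) (x : X) (hx : f x ≠ 0) : IsPredecessor X Y :=
  .single ⟨hX, hY, ⟨⟨ModuleCat.ofHom f⟩, (RightMod.hom_ne_zero_iff _).2 ⟨x, hx⟩⟩⟩

theorem leftPart_of_isPredecessor {X Y : RightMod A} (hX : IsIndec X) (h : IsPredecessor X Y)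
    (hY : leftPart A Y) : leftPart A X :=
  ⟨hX, fun Z hZ => hY.2 Z (hZ.trans h)⟩

/-- Induction along a path: it is enough to find a class closed under one-step predecessors and
consisting of modules of projective dimension at most one. -/
theorem leftPart_of_closed {C : RightMod A → Prop}
    (hC : ∀ X Y : RightMod A, IsIndec X → IsIndec Y → ∀ f : X →ₗ[Aᵐᵒᵖ] Y, f ≠ 0 → C Y → C X)
    (hpd : ∀ X : RightMod A, C X → HasProjectiveDimensionLE X.obj 1) {X : RightMod A}
    (hX : IsIndec X) (h : C X) : leftPart A X := by
  refine ⟨hX, fun Y hY => hpd Y ?_⟩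
  refine Relation.TransGen.head_induction_on hY ?_ ?_
  · rintro a ⟨ha, hX, f, hf⟩
    refine hC _ _ ha hX f.hom.hom (fun h0 => hf ?_) h
    ext x
    exact LinearMap.congr_fun h0 x
  · rintro a c ⟨ha, hc, f, hf⟩ - h
    refine hC _ _ ha hc f.hom.hom (fun h0 => hf ?_) h
    ext x
    exact LinearMap.congr_fun h0 x

/-- Every finitely generated module over a right artinian ring is a finite direct sum of
indecomposable modules. -/
theorem RightMod.exists_indec_decomposition [IsArtinianRing Aᵐᵒᵖ] (X : RightMod A) :
    ∃ (n : ℕ) (Y : Fin n → RightMod A), (∀ i, IsIndec (Y i)) ∧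
      Nonempty (X ≃ₗ[Aᵐᵒᵖ] (∀ i, Y i)) := by
  -- Well-founded induction on submodules of the artinian module `X`. Arbitrary finite index types
  -- let two decompositions be joined by a disjoint union.
  suffices H : ∀ N : Submodule Aᵐᵒᵖ X, ∃ (ι : Type) (_ : Finite ι) (Y : ι → RightMod A),
      (∀ i, IsIndec (Y i)) ∧ Nonempty (N ≃ₗ[Aᵐᵒᵖ] (∀ i, Y i)) by
    obtain ⟨ι, _, Y, hY, ⟨e⟩⟩ := H ⊤
    let σ := Finite.equivFin ι
    refine ⟨Nat.card ι, fun i => Y (σ.symm i), fun i => hY _, ⟨Submodule.topEquiv.symm.trans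
      (e.trans (LinearEquiv.piCongrLeft Aᵐᵒᵖ (fun i => Y i) σ.symm).symm)⟩⟩
  intro N
  induction N using WellFoundedLT.induction with
  | ind N ih =>
  by_cases hN : Nontrivial N
  swap
  · have := not_nontrivial_iff_subsingleton.1 hN
    exact ⟨Empty, inferInstance, fun e => e.elim, fun e => e.elim,
      ⟨{ (0 : N →ₗ[Aᵐᵒᵖ] _) with
        invFun := 0
        left_inv := fun _ => Subsingleton.elim _ _
        right_inv := fun _ => Subsingleton.elim _ _ }⟩⟩
  by_cases hI : IsIndec (FGModuleCat.of Aᵐᵒᵖ N)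
  · exact ⟨Unit, inferInstance, fun _ => FGModuleCat.of Aᵐᵒᵖ N, fun _ => hI,
      ⟨(LinearEquiv.piUnique Aᵐᵒᵖ (fun _ : Unit => N)).symm⟩⟩
  have : ∃ p q : Submodule Aᵐᵒᵖ N, IsCompl p q ∧ p ≠ ⊥ ∧ q ≠ ⊥ := by
    by_contra! h
    exact hI ⟨hN, fun p q hpq => or_iff_not_imp_left.2 fun hp => h p q hpq hp⟩
  obtain ⟨p, q, hpq, hp, hq⟩ := this
  have key : ∀ p q : Submodule Aᵐᵒᵖ N, IsCompl p q → q ≠ ⊥ → p.map N.subtype < N := by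
    intro p q hpq hq
    refine lt_of_le_of_ne (Submodule.map_subtype_le _ _) fun h => hq ?_
    have hp : p = ⊤ := by
      refine Submodule.map_injective_of_injective N.injective_subtype ?_
      rw [h, Submodule.map_subtype_top]
    rw [hp] at hpq
    exact top_disjoint.1 hpq.disjoint
  obtain ⟨ι₁, _, Y₁, hY₁, ⟨e₁⟩⟩ := ih _ (key p q hpq hq)
  obtain ⟨ι₂, _, Y₂, hY₂, ⟨e₂⟩⟩ := ih _ (key q p hpq.symm hp)
  refine ⟨ι₁ ⊕ ι₂, inferInstance, Sum.elim Y₁ Y₂, ?_, ⟨?_⟩⟩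
  · rintro (i | i)
    exacts [hY₁ i, hY₂ i]
  · exact (Submodule.prodEquivOfIsCompl p q hpq).symm.trans
      ((LinearEquiv.prodCongr
        ((Submodule.equivMapOfInjective _ N.injective_subtype p).trans e₁)
        ((Submodule.equivMapOfInjective _ N.injective_subtype q).trans e₂)).trans
        (LinearEquiv.sumPiEquivProdPi Aᵐᵒᵖ ι₁ ι₂ (fun i => (Sum.elim Y₁ Y₂ i).carrier)).symm)

theorem addClosure_of_decomposition [IsArtinianRing Aᵐᵒᵖ] {C : ObjectProperty (RightMod A)}
    {D : RightMod A → Prop}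
    (hD : ∀ X Y : RightMod A, D X → IsIndec Y → ∀ f : Y →ₗ[Aᵐᵒᵖ] X, Function.Injective f → C Y)
    (X : RightMod A) (hX : D X) : addClosure C X := by
  obtain ⟨n, Y, hY, ⟨e⟩⟩ := RightMod.exists_indec_decomposition X
  refine ⟨n, Y, fun i => hD X _ hX (hY i)
      (e.symm.toLinearMap ∘ₗ LinearMap.single Aᵐᵒᵖ (fun i => Y i) i) ?_,
    FGModuleCat.of Aᵐᵒᵖ PUnit, ⟨?_⟩⟩
  · exact e.symm.injective.comp (Pi.single_injective (M := fun i => (Y i).carrier) i)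
  · exact (LinearEquiv.prodUnique (R := Aᵐᵒᵖ) (M := X) (M₂ := PUnit.{u + 1})).trans e

/-- The indecomposable modules in `addClosure C` are predecessors of modules in `C`. -/
theorem IsIndec.isPredecessor_of_addClosure {C : ObjectProperty (RightMod A)}
    (hC : ∀ X, C X → IsIndec X) {X : RightMod A} (hX : IsIndec X) (h : addClosure C X) :
    ∃ Y, C Y ∧ IsPredecessor X Y := by
  obtain ⟨n, Y, hY, Z, ⟨e⟩⟩ := h
  have := hX.1
  obtain ⟨x, hx⟩ := exists_ne (0 : X)
  have hex : e (x, 0) ≠ 0 := by simpa using hx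
  obtain ⟨i, hi⟩ := Function.ne_iff.1 hex
  exact ⟨Y i, hY i, .of_linearMap hX (hC _ (hY i))
    (LinearMap.proj i ∘ₗ e.toLinearMap ∘ₗ LinearMap.inl _ _ _) x hi⟩

end RightModules

/-! ### Modules over the triangular matrix ring and their `H`-parts -/

namespace TriMatrix

section Basic

variable {H M R : Type u} [Ring H] [Ring R] [AddCommGroup M]

/-- The idempotent `[[0, 0], [0, 1]]`. -/
@[simps]
def eR : TriMatrix H M R := ⟨0, 0, 1⟩

/-- The idempotent `[[1, 0], [0, 0]]`. -/
@[simps]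
def eH : TriMatrix H M R := ⟨1, 0, 0⟩

/-- The matrix `[[h, 0], [0, 0]]`. -/
@[simps]
def ofH (h : H) : TriMatrix H M R := ⟨h, 0, 0⟩

/-- The matrix `[[0, 0], [m, 0]]`. -/
@[simps]
def ofM (m : M) : TriMatrix H M R := ⟨0, m, 0⟩

/-- The matrix `[[0, 0], [0, r]]`. -/
@[simps]
def ofR (r : R) : TriMatrix H M R := ⟨0, 0, r⟩

end Basic

variable {H M R : Type u} [Ring H] [Ring R] [AddCommGroup M] [Module R M] [Module Hᵐᵒᵖ M]
  [SMulCommClass R Hᵐᵒᵖ M]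

/-- The right `H`-module `H` as a module over the triangular matrix ring. -/
instance : Module (TriMatrix H M R)ᵐᵒᵖ H :=
  Module.compHom H (RingHom.op (toH : TriMatrix H M R →+* H))

theorem op_smul_H (a : TriMatrix H M R) (h : H) : op a • h = h * a.h := rfl

variable (H M R) in
/-- The largest submodule of `X` on which `[[h, 0], [m, r]]` acts as `h`. -/
def hPart (X : Type*) [AddCommGroup X] [Module (TriMatrix H M R)ᵐᵒᵖ X] :
    Submodule (TriMatrix H M R)ᵐᵒᵖ X where
  carrier := {x | op (eR : TriMatrix H M R) • x = 0}
  zero_mem' := smul_zero _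
  add_mem' {x y} hx hy := by
    simp only [Set.mem_ofPred_eq] at hx hy ⊢
    rw [smul_add, hx, hy, add_zero]
  smul_mem' a x hx := by
    simp only [Set.mem_ofPred_eq] at hx ⊢
    have : op eR * a = op (eR * ofR a.unop.r) * op (eR : TriMatrix H M R) := by
      apply unop_injective
      ext <;> simp
    rw [← mul_smul, this, mul_smul, hx, smul_zero]

variable (H M R) in
/-- The submodule of `X` generated by the elements `x · [[0, 0], [0, 1]]`. -/
def rPart (X : Type*) [AddCommGroup X] [Module (TriMatrix H M R)ᵐᵒᵖ X] :
    Submodule (TriMatrix H M R)ᵐᵒᵖ X :=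
  Submodule.span _ (Set.range fun x : X => op (eR : TriMatrix H M R) • x)

section Parts

variable {X Y : Type*} [AddCommGroup X] [Module (TriMatrix H M R)ᵐᵒᵖ X]
  [AddCommGroup Y] [Module (TriMatrix H M R)ᵐᵒᵖ Y]

theorem mem_hPart {x : X} : x ∈ hPart H M R X ↔ op (eR : TriMatrix H M R) • x = 0 := Iff.rfl

theorem eR_smul_mem_rPart (x : X) : op (eR : TriMatrix H M R) • x ∈ rPart H M R X :=
  Submodule.subset_span ⟨x, rfl⟩

theorem smul_mem_rPart {a : TriMatrix H M R} (ha : a.h = 0) (x : X) :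
    op a • x ∈ rPart H M R X := by
  have : op a = op a * op (eR : TriMatrix H M R) := by
    apply unop_injective
    ext <;> simp [ha]
  rw [this, mul_smul]
  exact Submodule.smul_mem _ _ (eR_smul_mem_rPart x)

theorem eH_smul_mem_hPart (x : X) : op (eH : TriMatrix H M R) • x ∈ hPart H M R X := by
  have : op (eR : TriMatrix H M R) * op eH = 0 := by
    apply unop_injective
    ext <;> simp
  rw [mem_hPart, ← mul_smul, this, zero_smul]

theorem ofM_smul_mem_hPart (m : M) (x : X) : op (ofM m : TriMatrix H M R) • x ∈ hPart H M R X := by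
  have : op (eR : TriMatrix H M R) * op (ofM m) = 0 := by
    apply unop_injective
    ext <;> simp
  rw [mem_hPart, ← mul_smul, this, zero_smul]

theorem smul_eq_of_mem_hPart {x : X} (hx : x ∈ hPart H M R X) {a b : TriMatrix H M R}
    (h : a.h = b.h) : op a • x = op b • x := by
  have : op a = op b + op (a - b) * op (eR : TriMatrix H M R) := by
    apply unop_injective
    ext <;> simp [h, sub_eq_add_neg]
  rw [this, add_smul, mul_smul, mem_hPart.1 hx, smul_zero, add_zero]

theorem eH_smul_of_mem_hPart {x : X} (hx : x ∈ hPart H M R X) :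
    op (eH : TriMatrix H M R) • x = x := by
  rw [smul_eq_of_mem_hPart hx (a := eH) (b := 1) rfl, op_one, one_smul]

theorem map_mem_hPart (f : X →ₗ[(TriMatrix H M R)ᵐᵒᵖ] Y) {x : X} (hx : x ∈ hPart H M R X) :
    f x ∈ hPart H M R Y := by
  rw [mem_hPart, ← map_smul, mem_hPart.1 hx, map_zero]

theorem map_mem_rPart (f : X →ₗ[(TriMatrix H M R)ᵐᵒᵖ] Y) {x : X} (hx : x ∈ rPart H M R X) :
    f x ∈ rPart H M R Y := by
  have : rPart H M R X ≤ (rPart H M R Y).comap f := by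
    refine Submodule.span_le.2 ?_
    rintro _ ⟨y, rfl⟩
    rw [SetLike.mem_coe, Submodule.mem_comap, map_smul]
    exact eR_smul_mem_rPart _
  exact this hx

theorem rPart_eq_bot_iff : rPart H M R X = ⊥ ↔ ∀ x : X, op (eR : TriMatrix H M R) • x = 0 := by
  rw [rPart, Submodule.span_eq_bot]
  simp

theorem rPart_eq_bot_iff_hPart : rPart H M R X = ⊥ ↔ hPart H M R X = ⊤ := by
  rw [rPart_eq_bot_iff, Submodule.eq_top_iff']
  rfl

theorem rPart_eq_bot_of_injective (f : Y →ₗ[(TriMatrix H M R)ᵐᵒᵖ] X) (hf : Function.Injective f)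
    (hX : rPart H M R X = ⊥) : rPart H M R Y = ⊥ := by
  rw [rPart_eq_bot_iff] at hX ⊢
  intro x
  apply hf
  rw [map_smul, hX, map_zero]

theorem rPart_eq_bot_of_surjective (f : X →ₗ[(TriMatrix H M R)ᵐᵒᵖ] Y)
    (hf : Function.Surjective f) (hX : rPart H M R X = ⊥) : rPart H M R Y = ⊥ := by
  rw [rPart_eq_bot_iff] at hX ⊢
  intro y
  obtain ⟨x, rfl⟩ := hf y
  rw [← map_smul, hX, map_zero]

theorem rPart_quotient_rPart : rPart H M R (X ⧸ rPart H M R X) = ⊥ := by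
  rw [rPart_eq_bot_iff]
  intro y
  obtain ⟨x, rfl⟩ := Submodule.Quotient.mk_surjective _ y
  rw [← Submodule.Quotient.mk_smul, Submodule.Quotient.mk_eq_zero]
  exact eR_smul_mem_rPart x

/-- `hPart` as a right `H`-module. -/
instance : SMul Hᵐᵒᵖ (hPart H M R X) where
  smul h x := op (ofH h.unop : TriMatrix H M R) • x

theorem op_smul_hPart (h : H) (x : hPart H M R X) :
    op h • x = op (ofH h : TriMatrix H M R) • x := rfl

instance : Module Hᵐᵒᵖ (hPart H M R X) where
  one_smul x := Subtype.ext (eH_smul_of_mem_hPart x.2)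
  mul_smul := fun ⟨h⟩ ⟨g⟩ x => by
    change op (g * h) • x = op h • op g • x
    simp only [op_smul_hPart]
    rw [← mul_smul]
    congr 1
    apply unop_injective
    ext <;> simp
  smul_zero h := smul_zero (op (ofH h.unop : TriMatrix H M R))
  smul_add h := smul_add (op (ofH h.unop : TriMatrix H M R))
  add_smul := fun ⟨h⟩ ⟨g⟩ x => by
    change op (h + g) • x = op h • x + op g • x
    simp only [op_smul_hPart]
    rw [← add_smul]
    congr 1
    apply unop_injective
    ext <;> simp
  zero_smul x := by
    change op 0 • x = 0
    rw [op_smul_hPart]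
    exact zero_smul (TriMatrix H M R)ᵐᵒᵖ x

theorem smul_hPart (a : TriMatrix H M R) (x : hPart H M R X) : op a • x = op a.h • x := by
  rw [op_smul_hPart]
  exact Subtype.ext (smul_eq_of_mem_hPart x.2 rfl)

/-- Linear maps over the matrix ring restrict to `H`-linear maps on the `hPart`s. -/
def hPartMap (f : X →ₗ[(TriMatrix H M R)ᵐᵒᵖ] Y) : hPart H M R X →ₗ[Hᵐᵒᵖ] hPart H M R Y where
  toFun x := ⟨f x, map_mem_hPart f x.2⟩
  map_add' x y := Subtype.ext (map_add f (x : X) y)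
  map_smul' h x := Subtype.ext (map_smul f (op (ofH h.unop : TriMatrix H M R)) (x : X))

end Parts

/-- A module on which the matrix ring acts through `H` is projective over the matrix ring if it is
projective over `H`. -/
theorem projective_of_projective_H {I Y : Type u} [AddCommGroup I] [Module Hᵐᵒᵖ I]
    [AddCommGroup Y] [Module (TriMatrix H M R)ᵐᵒᵖ Y] (e : I ≃+ Y)
    (he : ∀ (a : TriMatrix H M R) i, e (op a.h • i) = op a • e i) [Module.Projective Hᵐᵒᵖ I] :
    Module.Projective (TriMatrix H M R)ᵐᵒᵖ Y := by
  have he' : ∀ (a : TriMatrix H M R) y, e.symm (op a • y) = op a.h • e.symm y := by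
    intro a y
    rw [AddEquiv.symm_apply_eq, he, AddEquiv.apply_symm_apply]
  refine Module.Projective.of_lifting_property fun {B C} _ _ _ _ f g hf => ?_
  -- The image of `g` is killed by `eR`, and `f` is still surjective on `hPart`s since a preimage
  -- `b` may be replaced by `b · eH`. The lifting problem is therefore one over `H`.
  let g' : I →ₗ[Hᵐᵒᵖ] hPart H M R C :=
    { toFun := fun i => ⟨g (e i), by
        rw [mem_hPart, ← map_smul, ← he, eR_h, op_zero, zero_smul, map_zero, map_zero]⟩
      map_add' := fun i j => Subtype.ext (by simp)
      map_smul' := fun h i => Subtype.ext (by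
        have := congrArg g (he (ofH h.unop) i)
        exact this.trans (map_smul g _ _)) }
  have hf' : Function.Surjective (hPartMap f) := by
    rintro ⟨c, hc⟩
    obtain ⟨b, rfl⟩ := hf c
    refine ⟨⟨op (eH : TriMatrix H M R) • b, eH_smul_mem_hPart b⟩, Subtype.ext ?_⟩
    change f _ = f b
    rw [map_smul, eH_smul_of_mem_hPart hc]
  obtain ⟨l, hl⟩ := Module.projective_lifting_property (hPartMap f) g' hf'
  refine ⟨{ toFun := fun y => l (e.symm y), map_add' := by simp, map_smul' := ?_ }, ?_⟩
  · intro a y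
    obtain ⟨a, rfl⟩ := op_surjective a
    rw [he', map_smul, ← smul_hPart]
    rfl
  · ext y
    have := congrArg Subtype.val (LinearMap.congr_fun hl (e.symm y))
    exact this.trans (congrArg g (e.apply_symm_apply y))

theorem isHereditaryModule_H (hH : IsHereditary H) :
    IsHereditaryModule (TriMatrix H M R)ᵐᵒᵖ H := by
  intro N
  let I : Submodule Hᵐᵒᵖ H :=
    { N.toAddSubmonoid with
      smul_mem' := fun h x hx => N.smul_mem (op (ofH h.unop)) hx }
  have := hH I
  exact projective_of_projective_H (I := I) (AddEquiv.refl N) fun a i => rfl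

/-- The linear map `h ↦ x · [[h, 0], [0, 0]]`. -/
def ofHSMul {X : Type*} [AddCommGroup X] [Module (TriMatrix H M R)ᵐᵒᵖ X] (x : X) :
    H →ₗ[(TriMatrix H M R)ᵐᵒᵖ] X where
  toFun h := op (ofH h : TriMatrix H M R) • x
  map_add' h g := by
    rw [← add_smul]
    congr 1
    apply unop_injective
    ext <;> simp
  map_smul' a h := by
    obtain ⟨a, rfl⟩ := op_surjective a
    rw [RingHom.id_apply, ← mul_smul]
    congr 1
    apply unop_injective
    ext <;> simp [op_smul_H]

/-- A finitely generated module on which the matrix ring acts through `H` is a quotient of a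
power of `H`. -/
theorem exists_surjective_pi_H {X : Type*} [AddCommGroup X] [Module (TriMatrix H M R)ᵐᵒᵖ X]
    [Module.Finite (TriMatrix H M R)ᵐᵒᵖ X] (hX : rPart H M R X = ⊥) :
    ∃ (n : ℕ) (f : (Fin n → H) →ₗ[(TriMatrix H M R)ᵐᵒᵖ] X), Function.Surjective f := by
  obtain ⟨n, x, hx⟩ := Module.Finite.exists_fin (R := (TriMatrix H M R)ᵐᵒᵖ) (M := X)
  refine ⟨n, ∑ i, ofHSMul (x i) ∘ₗ LinearMap.proj i, ?_⟩
  rw [← LinearMap.range_eq_top, ← top_le_iff, ← hx, Submodule.span_le]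
  rintro _ ⟨i, rfl⟩
  refine ⟨Pi.single i 1, ?_⟩
  rw [rPart_eq_bot_iff_hPart] at hX
  rw [LinearMap.sum_apply, Finset.sum_eq_single i]
  · rw [LinearMap.comp_apply, LinearMap.proj_apply, Pi.single_eq_same]
    exact eH_smul_of_mem_hPart (M := M) (R := R) (x := x i) (hX ▸ Submodule.mem_top)
  · intro j _ hj
    simp [hj]
  · simp

theorem hasProjectiveDimensionLE_one_of_rPart_eq_bot (hH : IsHereditary H)
    (X : RightMod (TriMatrix H M R)) (hX : rPart H M R X = ⊥) :
    HasProjectiveDimensionLE X.obj 1 := by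
  obtain ⟨n, f, hf⟩ := exists_surjective_pi_H (X := X) hX
  have hn := (isHereditaryModule_H (M := M) (R := R) hH).pi_fin n
  have := hn.projective
  exact (hasProjectiveDimensionLE_one_iff_ker f hf).2 (hn _)

end TriMatrix

/-! ### Nonunits in noncommutative local artinian rings -/

section LocalRing

variable {R : Type*} [Ring R] [IsLocalRing R]

/-- The product `x * u` is idempotent, and a local ring has only the idempotents `0` and `1`. -/
theorem IsLocalRing.isUnit_of_mul_eq_one {u x : R} (h : u * x = 1) : IsUnit x := by
  have hi : (x * u) * (x * u) = x * u := by
    rw [mul_assoc, ← mul_assoc u, h, one_mul]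
  rcases IsLocalRing.isUnit_or_isUnit_of_add_one (add_sub_cancel (x * u) 1) with hu | hu
  · have hxu : x * u = 1 := by
      rw [← hu.mul_right_inj, hi, mul_one]
    exact ⟨⟨x, u, hxu, h⟩, rfl⟩
  · have h0 : x * u = 0 := by
      rw [← hu.mul_right_inj, mul_zero, sub_mul, one_mul, hi, sub_self]
    have hx : x = 0 := by
      rw [← mul_one x, ← h, ← mul_assoc, h0, zero_mul]
    rw [hx, mul_zero] at h
    exact absurd h zero_ne_one

theorem IsLocalRing.mem_jacobson_of_not_isUnit {x : R} (hx : ¬ IsUnit x) : x ∈ Ring.jacobson R := by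
  rw [← Ideal.jacobson_bot, Ideal.mem_jacobson_iff]
  intro y
  have hyx : ¬ IsUnit (y * x) := fun ⟨v, hv⟩ => hx <|
    isUnit_of_mul_eq_one (u := (v⁻¹ : Rˣ) * y) (by rw [mul_assoc, ← hv, Units.inv_mul])
  have h := IsLocalRing.isUnit_or_isUnit_of_add_one (a := -(y * x)) (b := 1 + y * x)
    (by abel)
  rw [IsUnit.neg_iff] at h
  obtain ⟨v, hv⟩ := h.resolve_left hyx
  refine ⟨(v⁻¹ : Rˣ), ?_⟩
  have : (↑v⁻¹ : R) * (1 + y * x) = 1 := by rw [← hv, Units.inv_mul]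
  rw [Ideal.mem_bot, mul_assoc, sub_eq_zero, ← this]
  noncomm_ring

theorem IsLocalRing.isNilpotent_of_not_isUnit [IsArtinianRing R] {x : R} (hx : ¬ IsUnit x) :
    IsNilpotent x := by
  obtain ⟨n, hn⟩ := IsSemiprimaryRing.isNilpotent (R := R)
  refine ⟨n, ?_⟩
  have := Ideal.pow_mem_pow (mem_jacobson_of_not_isUnit hx) n
  rwa [hn] at this

theorem IsNilpotent.exists_pow_ne_zero {R : Type*} [Ring R] [Nontrivial R] {x : R}
    (hx : IsNilpotent x) : ∃ n, x ^ n ≠ 0 ∧ x * x ^ n = 0 := by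
  refine ⟨nilpotencyClass x - 1, pow_pred_nilpotencyClass hx, ?_⟩
  rw [← pow_succ', Nat.sub_add_cancel (pos_nilpotencyClass_iff.2 hx)]
  exact pow_nilpotencyClass hx

end LocalRing

/-! ### The left part consists of `H`-modules -/

namespace TriMatrix

variable {H M R : Type u} [Ring H] [Ring R] [AddCommGroup M] [Module R M] [Module Hᵐᵒᵖ M]
  [SMulCommClass R Hᵐᵒᵖ M]

variable (H M R) in
/-- The indecomposable projective module given by the second row `(M, R)`. -/
def rowR : Submodule (TriMatrix H M R)ᵐᵒᵖ (TriMatrix H M R)ᵐᵒᵖ where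
  carrier := {a | a.unop.h = 0}
  zero_mem' := rfl
  add_mem' {a b} ha hb := by
    simp only [Set.mem_ofPred_eq] at ha hb ⊢
    simp [ha, hb]
  smul_mem' a b hb := by
    simp only [Set.mem_ofPred_eq] at hb ⊢
    simp [hb]

theorem mem_rowR {a : (TriMatrix H M R)ᵐᵒᵖ} : a ∈ rowR H M R ↔ a.unop.h = 0 := Iff.rfl

instance : Module.Projective (TriMatrix H M R)ᵐᵒᵖ (rowR H M R) := by
  refine Module.Projective.of_split (rowR H M R).subtype
    ((LinearMap.toSpanSingleton _ (TriMatrix H M R)ᵐᵒᵖ (op eR)).codRestrict _ fun a => ?_) ?_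
  · simp [mem_rowR]
  · ext ⟨a, ha⟩
    apply unop_injective
    rw [mem_rowR] at ha
    ext <;> simp [ha]

/-- Left multiplication by `r` on the second row `(M, R)`. -/
def rowRMul (r : R) : rowR H M R →ₗ[(TriMatrix H M R)ᵐᵒᵖ] (TriMatrix H M R)ᵐᵒᵖ :=
  LinearMap.toSpanSingleton _ (TriMatrix H M R)ᵐᵒᵖ (op (ofR r)) ∘ₗ (rowR H M R).subtype

theorem rowRMul_apply (r : R) (a : rowR H M R) :
    rowRMul r a = (a : (TriMatrix H M R)ᵐᵒᵖ) * op (ofR r) :=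
  rfl

/-- The element `[[0, 0], [0, 1]]` of the second row. -/
def rowRGen : rowR H M R := ⟨op eR, rfl⟩

theorem rowR_eq_smul_gen (a : rowR H M R) : a = (a : (TriMatrix H M R)ᵐᵒᵖ) • rowRGen := by
  refine Subtype.ext (unop_injective ?_)
  have := mem_rowR.1 a.2
  ext <;> simp [rowRGen, this]

/-- A section of the canonical map from the free module on the kernel writes each `t` with `r * t =
0` as a sum of products of such elements with nonunits. Iterating puts `t` in every power of the
radical, so `t = 0`; but the last nonzero power of `r` is such a `t`. -/
theorem not_projective_ker_rowRMul [IsLocalRing R] [IsArtinianRing R] {r : R} (hr : r ≠ 0)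
    (hu : ¬ IsUnit r) :
    ¬ Module.Projective (TriMatrix H M R)ᵐᵒᵖ (LinearMap.ker (rowRMul (H := H) (M := M) r)) := by
  set K := LinearMap.ker (rowRMul (H := H) (M := M) r)
  rintro ⟨s, hs⟩
  let κ : ∀ t : R, r * t = 0 → K := fun t ht => ⟨⟨op (ofR t), rfl⟩, by
    rw [LinearMap.mem_ker, rowRMul_apply]
    apply unop_injective
    ext <;> simp [ht]⟩
  have hκ : ∀ t (ht : r * t = 0) t' (ht' : r * (t * t') = 0),
      κ (t * t') ht' = op (ofR t' : TriMatrix H M R) • κ t ht := by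
    intro t ht t' ht'
    refine Subtype.ext (Subtype.ext (unop_injective ?_))
    ext <;> simp [κ]
  have hκ0 : κ 0 (mul_zero r) = 0 := by
    refine Subtype.ext (Subtype.ext (unop_injective ?_))
    ext <;> simp [κ]
  have hK : ∀ x : K, r * (x : rowR H M R).1.unop.r = 0 := by
    intro x
    have h1 : rowRMul r (x : rowR H M R) = 0 := x.2
    rw [rowRMul_apply] at h1
    exact congrArg (fun a => a.unop.r) h1
  have hnil : ∀ t, r * t = 0 → ¬ IsUnit t := by
    rintro _ ht ⟨v, rfl⟩
    exact hr (by simpa using ht)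
  -- If `t ^ n` is the last nonzero power of `t`, it kills `κ t`, hence also the coefficients of `s
  -- (κ t)`; a unit coefficient would give `t ^ n = 0`.
  have hcoef : ∀ t (ht : r * t = 0) (x : K), ¬ IsUnit (s (κ t ht) x).unop.r := by
    intro t ht x hx
    obtain ⟨n, hn, hn'⟩ := (IsLocalRing.isNilpotent_of_not_isUnit (hnil t ht)).exists_pow_ne_zero
    have h0 : r * (t * t ^ n) = 0 := by rw [hn', mul_zero]
    have h1 : op (ofR (t ^ n) : TriMatrix H M R) • κ t ht = 0 := by
      rw [← hκ t ht _ h0, ← hκ0]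
      congr 1
    have h2 : (op (ofR (t ^ n) : TriMatrix H M R) • s (κ t ht)) x = 0 := by
      rw [← map_smul, h1, map_zero, Finsupp.zero_apply]
    have h3 : (s (κ t ht) x).unop.r * t ^ n = 0 := congrArg (fun a => a.unop.r) h2
    exact hn (by rwa [hx.mul_right_eq_zero] at h3)
  have hmem : ∀ n t, r * t = 0 → t ∈ Ring.jacobson R ^ n := by
    intro n
    induction n with
    | zero => intro t _; rw [Submodule.pow_zero, Ideal.one_eq_top]; exact Submodule.mem_top
    | succ n ih =>
      intro t ht
      have h1 := hs (κ t ht)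
      rw [Finsupp.linearCombination_apply, Finsupp.sum] at h1
      let ρ : K →+ R :=
        { toFun := fun x => (x : rowR H M R).1.unop.r
          map_zero' := rfl
          map_add' := fun _ _ => rfl }
      have h2 := congrArg ρ h1
      rw [map_sum] at h2
      have h3 : ρ (κ t ht) = t := rfl
      rw [← h3, ← h2]
      refine Ideal.sum_mem _ fun x _ => ?_
      have h4 : ρ (s (κ t ht) x • x) = ρ x * (s (κ t ht) x).unop.r := rfl
      rw [id, h4, Submodule.pow_succ]
      exact Ideal.mul_mem_mul (ih _ (hK x))
        (IsLocalRing.mem_jacobson_of_not_isUnit (hcoef t ht x))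
  obtain ⟨n, hn, hn'⟩ := (IsLocalRing.isNilpotent_of_not_isUnit hu).exists_pow_ne_zero
  obtain ⟨m, hm⟩ := IsSemiprimaryRing.isNilpotent (R := R)
  have := hmem m _ hn'
  rw [hm] at this
  exact hn this

/-- A module generated by an element `v = v · [[0, 0], [0, 1]]` is indecomposable. -/
theorem isIndec_of_generator [IsLocalRing R] (X : RightMod (TriMatrix H M R)) (v : X) (hv0 : v ≠ 0)
    (hv : op (eR : TriMatrix H M R) • v = v)
    (hspan : ∀ x : X, ∃ a : (TriMatrix H M R)ᵐᵒᵖ, x = a • v) : IsIndec X := by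
  refine ⟨⟨v, 0, hv0⟩, fun p q hpq => ?_⟩
  -- This uses `eR * A * eR = R`. Splitting `v` along `p` and `q` then gives `t` and `1 - t` in the
  -- local ring `R`, and whichever is a unit puts `v` in its summand.
  have key : ∀ x : X, ∃ t : R,
      op (eR : TriMatrix H M R) • x = op (ofR t : TriMatrix H M R) • v := by
    intro x
    obtain ⟨a, rfl⟩ := hspan x
    refine ⟨a.unop.r, ?_⟩
    rw [← hv, ← mul_smul, ← mul_smul, ← mul_smul]
    congr 1
    apply unop_injective
    ext <;> simp
  obtain ⟨a, ha, b, hb, hab⟩ := Submodule.mem_sup.1 (hpq.sup_eq_top ▸ Submodule.mem_top : v ∈ p ⊔ q)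
  obtain ⟨t, ht⟩ := key a
  have htop : ∀ (p : Submodule (TriMatrix H M R)ᵐᵒᵖ X) (t : R),
      op (ofR t : TriMatrix H M R) • v ∈ p → IsUnit t → p = ⊤ := by
    rintro p _ hp ⟨w, rfl⟩
    have hvp : v ∈ p := by
      have h := p.smul_mem (op (ofR ((w⁻¹ : Rˣ) : R))) hp
      rw [← mul_smul] at h
      convert h using 1
      nth_rw 1 [← hv]
      congr 1
      apply unop_injective
      ext <;> simp
    rw [Submodule.eq_top_iff']
    intro x
    obtain ⟨c, rfl⟩ := hspan x
    exact p.smul_mem c hvp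
  have hq : op (ofR (1 - t) : TriMatrix H M R) • v ∈ q := by
    have h1 : op (ofR (1 - t) : TriMatrix H M R) = op eR - op (ofR t) := by
      apply unop_injective
      ext <;> simp [sub_eq_add_neg]
    have h2 : op (ofR (1 - t) : TriMatrix H M R) • v = op (eR : TriMatrix H M R) • b := by
      rw [h1, sub_smul, ← ht, ← smul_sub, sub_eq_of_eq_add' hab.symm]
    exact h2 ▸ q.smul_mem _ hb
  rcases IsLocalRing.isUnit_or_isUnit_of_add_one (add_sub_cancel t 1) with h | h
  · have := htop p t (ht ▸ p.smul_mem _ ha) h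
    exact Or.inr (top_disjoint.1 (this ▸ hpq.disjoint))
  · have := htop q _ hq h
    exact Or.inl (disjoint_top.1 (this ▸ hpq.disjoint))

theorem rPart_eq_bot_of_leftPart [IsLocalRing R] [IsArtinianRing R]
    [IsNoetherianRing (TriMatrix H M R)ᵐᵒᵖ]
    (hR : ¬ ∀ r : R, r ≠ 0 → IsUnit r) (X : RightMod (TriMatrix H M R))
    (hX : leftPart (TriMatrix H M R) X) : rPart H M R X = ⊥ := by
  push Not at hR
  obtain ⟨r, hr, hu⟩ := hR
  rw [rPart_eq_bot_iff]
  by_contra! h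
  obtain ⟨x, hx⟩ := h
  let P := FGModuleCat.of (TriMatrix H M R)ᵐᵒᵖ (rowR H M R)
  let Q := FGModuleCat.of (TriMatrix H M R)ᵐᵒᵖ (LinearMap.range (rowRMul (H := H) (M := M) r))
  have hP : IsIndec P := by
    refine isIndec_of_generator P rowRGen ?_ ?_ fun a => ⟨_, rowR_eq_smul_gen a⟩
    · intro h
      have := congrArg (fun a : rowR H M R => a.1.unop.r) h
      exact one_ne_zero this
    · exact (rowR_eq_smul_gen rowRGen).symm
  have hQ : IsIndec Q := by
    refine isIndec_of_generator Q ((rowRMul r).rangeRestrict rowRGen) ?_ ?_ ?_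
    · intro h
      have h1 := congrArg (fun a : LinearMap.range (rowRMul (H := H) (M := M) r) => a.1.unop.r) h
      exact hr (by simpa [rowRMul_apply, rowRGen] using h1)
    · rw [← map_smul]
      exact congrArg _ (rowR_eq_smul_gen rowRGen).symm
    · intro y
      obtain ⟨a, rfl⟩ := (rowRMul (H := H) (M := M) r).surjective_rangeRestrict y
      refine ⟨a, ?_⟩
      rw [← map_smul]
      exact congrArg _ (rowR_eq_smul_gen a)
  have hQP : IsPredecessor Q P := by
    refine .of_linearMap hQ hP
      ((LinearMap.range (rowRMul r)).subtype.codRestrict (rowR H M R) ?_)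
      ((rowRMul r).rangeRestrict rowRGen) ?_
    · rintro ⟨_, a, rfl⟩
      simp [mem_rowR, rowRMul_apply]
    · intro h
      have h1 := congrArg (fun a : rowR H M R => a.1.unop.r) h
      have h2 : (rowRMul (H := H) (M := M) r rowRGen).unop.r = 0 := h1
      exact hr (by simpa [rowRMul_apply, rowRGen] using h2)
  have hPX : IsPredecessor P X := by
    refine .of_linearMap hP hX.1 (LinearMap.toSpanSingleton _ X x ∘ₗ (rowR H M R).subtype)
      rowRGen ?_
    exact hx
  have hpd := hX.2 Q (hQP.trans hPX)
  refine not_projective_ker_rowRMul (H := H) (M := M) hr hu ?_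
  have h1 := (hasProjectiveDimensionLE_one_iff_ker _
    (rowRMul (H := H) (M := M) r).surjective_rangeRestrict).1 hpd
  rwa [LinearMap.ker_rangeRestrict] at h1

end TriMatrix

/-! ### Splitting of `rPart` and injectivity of `M` -/

namespace TriMatrix

variable {H M R : Type u} [Ring H] [Ring R] [AddCommGroup M] [Module R M] [Module Hᵐᵒᵖ M]
  [SMulCommClass R Hᵐᵒᵖ M]

variable (H M R) in
/-- In every finitely generated module, the part generated by the elements
`x · [[0, 0], [0, 1]]` is the image of a projection. -/
def RPartSplits : Prop :=
  ∀ X : RightMod (TriMatrix H M R), ∃ π : X →ₗ[(TriMatrix H M R)ᵐᵒᵖ] X,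
    (∀ x, π x ∈ rPart H M R X) ∧
      ∀ x, π (op (eR : TriMatrix H M R) • x) = op (eR : TriMatrix H M R) • x

theorem eq_of_mem_rPart {X : Type*} [AddCommGroup X] [Module (TriMatrix H M R)ᵐᵒᵖ X]
    {π : X →ₗ[(TriMatrix H M R)ᵐᵒᵖ] X}
    (hπ : ∀ x, π (op (eR : TriMatrix H M R) • x) = op (eR : TriMatrix H M R) • x) {x : X}
    (hx : x ∈ rPart H M R X) : π x = x := by
  have : rPart H M R X ≤ LinearMap.ker (π - LinearMap.id) := by
    refine Submodule.span_le.2 ?_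
    rintro _ ⟨y, rfl⟩
    rw [SetLike.mem_coe, LinearMap.mem_ker, LinearMap.sub_apply, hπ, LinearMap.id_apply, sub_self]
  simpa [sub_eq_zero] using this hx

/-- The `H`-linear map `m ↦ x · [[0, 0], [m, 0]]`. -/
def ofMSMul {X : Type*} [AddCommGroup X] [Module (TriMatrix H M R)ᵐᵒᵖ X] (x : X) :
    M →ₗ[Hᵐᵒᵖ] hPart H M R X where
  toFun m := ⟨op (ofM m) • x, ofM_smul_mem_hPart m x⟩
  map_add' m n := by
    refine Subtype.ext ?_
    change op (ofM (m + n) : TriMatrix H M R) • x =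
      op (ofM m : TriMatrix H M R) • x + op (ofM n : TriMatrix H M R) • x
    rw [← add_smul]
    congr 1
    apply unop_injective
    ext <;> simp
  map_smul' h m := by
    refine Subtype.ext ?_
    change op (ofM (h • m) : TriMatrix H M R) • x =
      op (ofH h.unop : TriMatrix H M R) • op (ofM m : TriMatrix H M R) • x
    rw [← mul_smul]
    congr 1
    apply unop_injective
    ext <;> simp

theorem isHereditaryModule_op (hH : IsHereditary H) : IsHereditaryModule Hᵐᵒᵖ Hᵐᵒᵖ :=
  IsHereditaryModule.of_injective (X := H) hH
    { toFun := unop, map_add' := fun _ _ => rfl, map_smul' := fun _ _ => rfl } unop_injective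

theorem rPartSplits_of_injective (hH : IsHereditary H) (hM : Module.Injective Hᵐᵒᵖ M) :
    RPartSplits H M R := by
  intro X
  obtain ⟨n, x, hx⟩ := Module.Finite.exists_fin (R := (TriMatrix H M R)ᵐᵒᵖ) (M := X)
  let q : (Fin n → M) →ₗ[Hᵐᵒᵖ] hPart H M R X := ∑ i, ofMSMul (x i) ∘ₗ LinearMap.proj i
  have hN : ∀ (m : M) (y : X),
      (⟨op (ofM m) • y, ofM_smul_mem_hPart m y⟩ : hPart H M R X) ∈ LinearMap.range q := by
    intro m y
    obtain ⟨c, rfl⟩ := (Submodule.mem_span_range_iff_exists_fun _).1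
      (hx ▸ Submodule.mem_top : y ∈ Submodule.span (TriMatrix H M R)ᵐᵒᵖ (Set.range x))
    -- For `y = ∑ xᵢ cᵢ` only the `R`-entry of `cᵢ` survives in `cᵢ * ofM m`. Hence the range of `q`
    -- is all of `XM`.
    refine ⟨fun i => (c i).unop.r • m, Subtype.ext ?_⟩
    simp only [q, LinearMap.sum_apply, LinearMap.comp_apply, LinearMap.proj_apply,
      Submodule.coe_sum, Finset.smul_sum, ← mul_smul]
    refine Finset.sum_congr rfl fun i _ => ?_
    change op (ofM ((c i).unop.r • m) : TriMatrix H M R) • x i = _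
    congr 1
    apply unop_injective
    ext <;> simp
  have hI : Module.Injective Hᵐᵒᵖ (LinearMap.range q) :=
    Module.Injective.of_surjective_of_hereditary (isHereditaryModule_op hH)
      (Module.Injective.pi Hᵐᵒᵖ fun _ : Fin n => M) q.rangeRestrict q.surjective_rangeRestrict
  obtain ⟨p, hp⟩ := hI.out (LinearMap.range q).subtype Subtype.val_injective LinearMap.id
  have hpr : ∀ y, ((p y : hPart H M R X) : X) ∈ rPart H M R X := by
    intro y
    obtain ⟨m, hm⟩ := (p y).2
    rw [← hm]
    simp only [q, LinearMap.sum_apply, LinearMap.comp_apply, Submodule.coe_sum]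
    exact Submodule.sum_mem _ fun i _ => smul_mem_rPart rfl _
  let θ : X →+ hPart H M R X :=
    { toFun := fun y => ⟨op eH • y, eH_smul_mem_hPart y⟩
      map_zero' := Subtype.ext (smul_zero _)
      map_add' := fun _ _ => Subtype.ext (smul_add _ _ _) }
  have hθ : ∀ (a : TriMatrix H M R) (y : X), θ (op a • y) = op a • θ y +
      ⟨op (ofM a.m) • y, ofM_smul_mem_hPart _ _⟩ := by
    intro a y
    refine Subtype.ext ?_
    change op (eH : TriMatrix H M R) • op a • y = op a • op (eH : TriMatrix H M R) • y +
      op (ofM a.m : TriMatrix H M R) • y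
    rw [← mul_smul, ← mul_smul, ← add_smul]
    congr 1
    apply unop_injective
    ext <;> simp
  -- The projection is `y ↦ y · eR + p (y · eH)`. The `H`-component `θ` is linear up to a term in
  -- `XM`, which `p` fixes; this term is exactly what linearity of the sum requires.
  refine ⟨{ toFun := fun y => op (eR : TriMatrix H M R) • y + (p (θ y) : hPart H M R X)
            map_add' := fun y z => ?_
            map_smul' := fun a y => ?_ }, fun y => ?_, fun y => ?_⟩
  · simp only [smul_add, map_add, Submodule.coe_add]
    abel
  · obtain ⟨a, rfl⟩ := op_surjective a
    have h1 : p ⟨op (ofM a.m) • y, ofM_smul_mem_hPart _ _⟩ = ⟨_, hN a.m y⟩ := hp ⟨_, hN a.m y⟩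
    rw [hθ, map_add, h1, smul_hPart, map_smul, RingHom.id_apply, smul_add, Submodule.coe_add,
      Submodule.coe_add, Submodule.coe_smul, ← smul_hPart, Submodule.coe_smul,
      add_left_comm, add_comm]
    congr 1
    rw [← mul_smul, ← mul_smul, ← add_smul]
    congr 1
    apply unop_injective
    ext <;> simp
  · exact Submodule.add_mem _ (eR_smul_mem_rPart y) (hpr _)
  · have h1 : θ (op (eR : TriMatrix H M R) • y) = 0 := by
      refine Subtype.ext ?_
      change op (eH : TriMatrix H M R) • op (eR : TriMatrix H M R) • y = 0
      rw [← mul_smul, ← zero_smul (TriMatrix H M R)ᵐᵒᵖ y]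
      congr 1
      apply unop_injective
      ext <;> simp
    change op (eR : TriMatrix H M R) • op (eR : TriMatrix H M R) • y + (p (θ _) : hPart H M R X) = _
    rw [h1, map_zero, Submodule.coe_zero, Submodule.coe_zero, add_zero, ← mul_smul]
    congr 1
    apply unop_injective
    ext <;> simp

theorem injective_of_rPartSplits (h : RPartSplits H M R) : Module.Injective Hᵐᵒᵖ M := by
  refine Module.Baer.injective fun I g => ?_
  -- `J` is the graph of `-g`. In the quotient by `J`, each `i` in `I` is identified with `g i`,
  -- while `M` still embeds.
  let J : Submodule (TriMatrix H M R)ᵐᵒᵖ (TriMatrix H M R)ᵐᵒᵖ :=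
    { carrier := {a | a.unop.r = 0 ∧ ∃ ha : op a.unop.h ∈ I, a.unop.m = - g ⟨op a.unop.h, ha⟩}
      zero_mem' := ⟨rfl, I.zero_mem, (neg_eq_zero.2 (map_zero g)).symm⟩
      add_mem' := by
        rintro a b ⟨ha, ha', ha''⟩ ⟨hb, hb', hb''⟩
        refine ⟨by simp [ha, hb], I.add_mem ha' hb', ?_⟩
        change a.unop.m + b.unop.m = _
        rw [ha'', hb'', ← neg_add, ← map_add]
        rfl
      smul_mem' := by
        rintro a b ⟨hb, hb', hb''⟩
        refine ⟨by simp [hb], I.smul_mem (op a.unop.h) hb', ?_⟩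
        change op a.unop.h • b.unop.m + b.unop.r • a.unop.m = _
        rw [hb, hb'', zero_smul, add_zero, smul_neg, ← map_smul]
        rfl }
  have hJ : ∀ m : M, op (ofM m) ∈ J → m = 0 := by
    rintro m ⟨-, hm, h1⟩
    have h2 : (⟨_, hm⟩ : I) = 0 := rfl
    rw [h2, map_zero, neg_zero] at h1
    exact h1
  obtain ⟨π, hπ, hπ'⟩ := h (FGModuleCat.of _ ((TriMatrix H M R)ᵐᵒᵖ ⧸ J))
  have hr : ∀ x ∈ rPart H M R ((TriMatrix H M R)ᵐᵒᵖ ⧸ J),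
      ∃ a : (TriMatrix H M R)ᵐᵒᵖ, a.unop.h = 0 ∧ J.mkQ a = x := by
    have : rPart H M R ((TriMatrix H M R)ᵐᵒᵖ ⧸ J) ≤ (rowR H M R).map J.mkQ := by
      refine Submodule.span_le.2 ?_
      rintro _ ⟨y, rfl⟩
      obtain ⟨a, rfl⟩ := J.mkQ_surjective y
      refine ⟨op eR * a, ?_, rfl⟩
      simp [mem_rowR]
    exact fun x hx => this hx
  -- The `M`-entry of a representative of `π 1` is the element whose multiples extend `g`.
  obtain ⟨b, hb, hb'⟩ := hr _ (hπ (J.mkQ 1))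
  have key : ∀ h : H, π (J.mkQ (op (ofH h))) = J.mkQ (op (ofM (op h • b.unop.m))) := by
    intro h
    have h1 : op (ofH h) = op (ofH h : TriMatrix H M R) • (1 : (TriMatrix H M R)ᵐᵒᵖ) := by
      rw [smul_eq_mul, mul_one]
    rw [h1, map_smul, map_smul, ← hb', ← map_smul]
    congr 1
    apply unop_injective
    ext <;> simp [hb]
  refine ⟨LinearMap.toSpanSingleton Hᵐᵒᵖ M b.unop.m, fun i hi => ?_⟩
  have h1 : J.mkQ (op (ofH i.unop)) = J.mkQ (op (ofM (g ⟨i, hi⟩))) := by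
    rw [← sub_eq_zero, ← map_sub, Submodule.mkQ_apply, Submodule.Quotient.mk_eq_zero]
    refine ⟨by simp [sub_eq_add_neg], by simpa [sub_eq_add_neg] using hi, ?_⟩
    simp [sub_eq_add_neg]
  have h2 : J.mkQ (op (ofM (g ⟨i, hi⟩))) ∈ rPart H M R ((TriMatrix H M R)ᵐᵒᵖ ⧸ J) := by
    have : op (ofM (g ⟨i, hi⟩)) =
        op (ofM (g ⟨i, hi⟩) : TriMatrix H M R) • (1 : (TriMatrix H M R)ᵐᵒᵖ) := by
      rw [smul_eq_mul, mul_one]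
    rw [this, map_smul]
    exact smul_mem_rPart rfl _
  have h3 := key i.unop
  rw [h1, eq_of_mem_rPart hπ' h2, ← sub_eq_zero, ← map_sub, Submodule.mkQ_apply,
    Submodule.Quotient.mk_eq_zero] at h3
  have h4 : op (ofM (g ⟨i, hi⟩)) - op (ofM (op i.unop • b.unop.m)) =
      op (ofM (g ⟨i, hi⟩ - op i.unop • b.unop.m) : TriMatrix H M R) := by
    apply unop_injective
    ext <;> simp [sub_eq_add_neg]
  rw [h4] at h3
  exact (sub_eq_zero.1 (hJ _ h3)).symm

theorem rPart_eq_bot_or_eq_top (h : RPartSplits H M R) {X : RightMod (TriMatrix H M R)}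
    (hX : IsIndec X) : rPart H M R X = ⊥ ∨ rPart H M R X = ⊤ := by
  obtain ⟨π, hπ, hπ'⟩ := h X
  have hker : ∀ x, x - π x ∈ LinearMap.ker π := by
    intro x
    rw [LinearMap.mem_ker, map_sub, eq_of_mem_rPart hπ' (hπ x), sub_self]
  have hcompl : IsCompl (rPart H M R X) (LinearMap.ker π) := by
    constructor
    · rw [Submodule.disjoint_def]
      intro x hx hx'
      rw [← eq_of_mem_rPart hπ' hx, LinearMap.mem_ker.1 hx']
    · rw [codisjoint_iff, Submodule.eq_top_iff']
      intro x
      exact Submodule.mem_sup.2 ⟨π x, hπ x, x - π x, hker x, by abel⟩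
  refine (hX.2 _ _ hcompl).imp id fun hk => ?_
  rw [Submodule.eq_top_iff']
  intro x
  have := hker x
  rw [hk, Submodule.mem_bot, sub_eq_zero] at this
  exact this ▸ hπ x

theorem leftPart_of_rPart_eq_bot (hH : IsHereditary H) (h : RPartSplits H M R)
    {X : RightMod (TriMatrix H M R)} (hX : IsIndec X) (hX' : rPart H M R X = ⊥) :
    leftPart (TriMatrix H M R) X := by
  refine leftPart_of_closed (C := fun X => rPart H M R X = ⊥) ?_
    (hasProjectiveDimensionLE_one_of_rPart_eq_bot hH) hX hX'
  intro X Y hX _ f hf hY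
  refine (rPart_eq_bot_or_eq_top h hX).resolve_right fun ht => hf ?_
  ext x
  have := map_mem_rPart f (ht ▸ Submodule.mem_top : x ∈ rPart H M R X)
  rw [hY] at this
  exact this

/-- If the left part consists of all indecomposable modules on which the matrix ring acts through
`H`, then `RPartSplits` holds. -/
theorem rPartSplits_of_leftPart [IsArtinianRing (TriMatrix H M R)ᵐᵒᵖ]
    (h : ∀ X : RightMod (TriMatrix H M R), leftPart (TriMatrix H M R) X ↔
      IsIndec X ∧ rPart H M R X = ⊥) : RPartSplits H M R := by
  have hI : ∀ X : RightMod (TriMatrix H M R), IsIndec X →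
      rPart H M R X = ⊥ ∨ rPart H M R X = ⊤ := by
    intro X hX
    refine or_iff_not_imp_right.2 fun ht => ?_
    -- If `rPart` is proper, `X` maps nontrivially to an indecomposable summand of `X / rPart`. That
    -- summand is an `H`-module, so it lies in the left part, and hence so does `X`.
    obtain ⟨n, Y, hY, ⟨e⟩⟩ := RightMod.exists_indec_decomposition
      (FGModuleCat.of (TriMatrix H M R)ᵐᵒᵖ (X ⧸ rPart H M R X))
    obtain ⟨x, hx⟩ : ∃ x : X, x ∉ rPart H M R X := by
      by_contra! h'
      exact ht ((Submodule.eq_top_iff').2 h')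
    have hx' : e ((rPart H M R X).mkQ x) ≠ 0 := by
      rw [Ne, LinearEquiv.map_eq_zero_iff, Submodule.mkQ_apply, Submodule.Quotient.mk_eq_zero]
      exact hx
    obtain ⟨i, hi⟩ := Function.ne_iff.1 hx'
    have hYi : rPart H M R (Y i) = ⊥ :=
      rPart_eq_bot_of_surjective (LinearMap.proj i ∘ₗ e.toLinearMap)
        ((LinearMap.proj_surjective (R := (TriMatrix H M R)ᵐᵒᵖ) (φ := fun i => Y i) i).comp
          e.surjective) rPart_quotient_rPart
    exact ((h X).1 (leftPart_of_isPredecessor hX (.of_linearMap hX (hY i)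
      (LinearMap.proj i ∘ₗ e.toLinearMap ∘ₗ (rPart H M R X).mkQ) x hi)
      ((h _).2 ⟨hY i, hYi⟩))).2
  intro X
  obtain ⟨n, Y, hY, ⟨e⟩⟩ := RightMod.exists_indec_decomposition X
  classical
  -- `D` keeps the summands generated by `eR` and kills the others, on which `eR` acts as zero.
  let D : (∀ i, Y i) →ₗ[(TriMatrix H M R)ᵐᵒᵖ] (∀ i, Y i) :=
    LinearMap.pi fun i => if rPart H M R (Y i) = ⊤ then LinearMap.proj i else 0
  refine ⟨e.symm.toLinearMap ∘ₗ D ∘ₗ e.toLinearMap, fun x => ?_, fun x => ?_⟩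
  · refine map_mem_rPart e.symm.toLinearMap ?_
    change D (e x) ∈ _
    rw [← LinearMap.sum_single_apply (fun i => (Y i).carrier) (D (e x))]
    refine Submodule.sum_mem _ fun i _ => ?_
    refine map_mem_rPart
      (LinearMap.single (TriMatrix H M R)ᵐᵒᵖ (fun i => (Y i).carrier) i) (x := D (e x) i) ?_
    by_cases hi : rPart H M R (Y i) = ⊤
    · rw [hi]
      exact Submodule.mem_top
    · simp [D, hi]
  · change e.symm (D (e _)) = _
    rw [LinearEquiv.symm_apply_eq, map_smul]
    ext i
    by_cases hi : rPart H M R (Y i) = ⊤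
    · simp [D, hi]
    · have := rPart_eq_bot_iff.1 ((hI _ (hY i)).resolve_right hi) (e x i)
      simp [D, hi, this]

end TriMatrix

open Limits

/-! ### Hereditary modules in the left part, and cokernels -/

section HereditaryIndec

variable {A : Type u} [Ring A]

theorem addClosure_of_linearEquiv {C : ObjectProperty (RightMod A)} {X Y : RightMod A}
    (e : X ≃ₗ[Aᵐᵒᵖ] Y) (h : addClosure C X) : addClosure C Y := by
  obtain ⟨n, W, hW, Z, ⟨f⟩⟩ := h
  exact ⟨n, W, hW, Z, ⟨(e.symm.prodCongr (LinearEquiv.refl _ Z)).trans f⟩⟩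

/-- A nonzero map from an indecomposable module to a hereditary module is injective. -/
theorem IsIndec.injective_of_isHereditaryModule {X Y : RightMod A} (hX : IsIndec X)
    (hY : IsHereditaryModule Aᵐᵒᵖ Y) (f : X →ₗ[Aᵐᵒᵖ] Y) (hf : f ≠ 0) : Function.Injective f := by
  have := hY (LinearMap.range f)
  obtain ⟨s, hs⟩ := Module.projective_lifting_property f.rangeRestrict LinearMap.id
    f.surjective_rangeRestrict
  have hs' : ∀ y, f.rangeRestrict (s y) = y := LinearMap.congr_fun hs
  -- The image of `f` is projective, so `ker f` is a direct summand of the indecomposable module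
  -- `X`.
  have hi : IsIdempotentElem (s ∘ₗ f.rangeRestrict) := by
    ext x
    simp [hs']
  have hk : LinearMap.ker (s ∘ₗ f.rangeRestrict) = LinearMap.ker f := by
    rw [LinearMap.ker_comp_of_ker_eq_bot _
      (LinearMap.ker_eq_bot.2 (Function.LeftInverse.injective hs')), LinearMap.ker_rangeRestrict]
  have hc := LinearMap.IsIdempotentElem.isCompl hi
  rw [hk] at hc
  rcases hX.2 _ _ hc with h | h
  · refine absurd ?_ hf
    rw [h] at hc
    exact LinearMap.ker_eq_top.1 (bot_codisjoint.1 hc.codisjoint)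
  · exact LinearMap.ker_eq_bot.1 h

theorem hasProjectiveDimensionLE_one_of_projective (X : RightMod A)
    (hX : Module.Projective Aᵐᵒᵖ X) : HasProjectiveDimensionLE X.obj 1 := by
  have : Module.Projective Aᵐᵒᵖ (LinearMap.ker (LinearMap.id : X →ₗ[Aᵐᵒᵖ] X)) := by
    rw [LinearMap.ker_id]
    infer_instance
  exact (hasProjectiveDimensionLE_one_iff_ker LinearMap.id Function.surjective_id).2 this

theorem leftPart_of_isHereditaryModule {X : RightMod A} (hX : IsIndec X)
    (h : IsHereditaryModule Aᵐᵒᵖ X) : leftPart A X :=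
  leftPart_of_closed (C := fun X => IsHereditaryModule Aᵐᵒᵖ X)
    (fun _ _ hX _ f hf hY => hY.of_injective f (hX.injective_of_isHereditaryModule hY f hf))
    (fun X h => hasProjectiveDimensionLE_one_of_projective X h.projective) hX h

theorem addClosure_leftPart_of_isHereditaryModule [IsArtinianRing Aᵐᵒᵖ] (X : RightMod A)
    (hX : IsHereditaryModule Aᵐᵒᵖ X) : addClosure (leftPart A) X :=
  addClosure_of_decomposition (D := fun X => IsHereditaryModule Aᵐᵒᵖ X)
    (fun _ _ hX hY f hf => leftPart_of_isHereditaryModule hY (hX.of_injective f hf)) X hX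

/-- An abelian exact subcategory contains the cokernels of its morphisms. -/
theorem addClosure_of_presentation {C : ObjectProperty (RightMod A)}
    (hC : IsAbelianExact (addClosure C)) {P X : RightMod A} (f : P →ₗ[Aᵐᵒᵖ] X)
    (hf : Function.Surjective f) (hP : addClosure C P) [Module.Finite Aᵐᵒᵖ (LinearMap.ker f)]
    (hK : addClosure C (FGModuleCat.of Aᵐᵒᵖ (LinearMap.ker f))) : addClosure C X := by
  obtain ⟨⟨_⟩, hex⟩ := hC
  obtain ⟨-, _⟩ := (exactFunctor_iff _).1 hex
  let P' : (addClosure C).FullSubcategory := ⟨P, hP⟩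
  let K' : (addClosure C).FullSubcategory := ⟨_, hK⟩
  let g : K' ⟶ P' := ⟨⟨ModuleCat.ofHom (LinearMap.ker f).subtype⟩⟩
  let z : K' ⟶ P' := ⟨0⟩
  -- `Q` is the cokernel of `ker f → P` formed inside the subcategory. Exactness of the inclusion
  -- makes it a cokernel in `mod_A` too, so it is isomorphic to `X`.
  let Q := coequalizer g z
  let c := isColimitOfHasCoequalizerOfPreservesColimit (addClosure C).ι g z
  let π : P ⟶ Q.obj := (addClosure C).ι.map (coequalizer.π g z)
  let f' : P ⟶ X := ⟨ModuleCat.ofHom f⟩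
  have hgf : (addClosure C).ι.map g ≫ f' = (addClosure C).ι.map z ≫ f' := by
    ext x
    change f x.1 = f 0
    rw [x.2, map_zero]
  obtain ⟨d, hd⟩ := Cofork.IsColimit.desc' c f' hgf
  have hd' : ∀ x, d.hom.hom (π.hom.hom x) = f x := fun x =>
    LinearMap.congr_fun (congrArg (fun h => h.hom.hom) hd) x
  have hker : ∀ x, f x = 0 → π.hom.hom x = 0 := by
    intro x hx
    have h1 : (addClosure C).ι.map g ≫ π = (addClosure C).ι.map z ≫ π := by
      rw [← Functor.map_comp, coequalizer.condition, Functor.map_comp]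
    have h2 := LinearMap.congr_fun (congrArg (fun h => h.hom.hom) h1) ⟨x, hx⟩
    exact h2.trans (map_zero π.hom.hom)
  have hsurj : Function.Surjective π.hom.hom := by
    rw [← LinearMap.range_eq_top]
    let p : Q.obj ⟶ FGModuleCat.of Aᵐᵒᵖ (Q.obj ⧸ LinearMap.range π.hom.hom) :=
      ⟨ModuleCat.ofHom (LinearMap.range π.hom.hom).mkQ⟩
    have hp : p = 0 := by
      refine Cofork.IsColimit.hom_ext c ?_
      ext x
      change (LinearMap.range π.hom.hom).mkQ (π.hom.hom x) = 0
      simp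
    rw [Submodule.eq_top_iff']
    intro y
    have : (LinearMap.range π.hom.hom).mkQ y = 0 :=
      LinearMap.congr_fun (congrArg (fun h => h.hom.hom) hp) y
    simpa using this
  refine addClosure_of_linearEquiv (X := Q.obj) (LinearEquiv.ofBijective d.hom.hom ⟨?_, ?_⟩)
    Q.property
  · rw [injective_iff_map_eq_zero]
    intro y hy
    obtain ⟨x, rfl⟩ := hsurj y
    rw [hd'] at hy
    exact hker x hy
  · intro y
    obtain ⟨x, rfl⟩ := hf y
    exact ⟨_, hd' x⟩

end HereditaryIndec

/-! ### From abelian exactness to the left part -/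

namespace TriMatrix

variable {H M R : Type u} [Ring H] [Ring R] [AddCommGroup M] [Module R M] [Module Hᵐᵒᵖ M]
  [SMulCommClass R Hᵐᵒᵖ M]

/-- Present `X` as a quotient of a power of `H`. Both that power and the kernel are hereditary, so
they lie in the additive closure, and so does their cokernel `X`. -/
theorem leftPart_of_isAbelianExact [IsArtinianRing (TriMatrix H M R)ᵐᵒᵖ]
    (hH : IsHereditary H)
    (h : IsAbelianExact (addClosure (leftPart (TriMatrix H M R))))
    {X : RightMod (TriMatrix H M R)} (hX : IsIndec X) (hX' : rPart H M R X = ⊥) :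
    leftPart (TriMatrix H M R) X := by
  obtain ⟨n, f, hf⟩ := exists_surjective_pi_H (X := X) hX'
  have hn := (isHereditaryModule_H (M := M) (R := R) hH).pi_fin n
  have : Module.Finite (TriMatrix H M R)ᵐᵒᵖ H := by
    refine ⟨⟨{1}, ?_⟩⟩
    rw [Submodule.eq_top_iff']
    intro x
    rw [Finset.coe_singleton, Submodule.mem_span_singleton]
    exact ⟨op (ofH x), by rw [op_smul_H, ofH_h, one_mul]⟩
  have := addClosure_of_presentation h (P := FGModuleCat.of _ (Fin n → H)) f hf
    (addClosure_leftPart_of_isHereditaryModule _ hn)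
    (addClosure_leftPart_of_isHereditaryModule _
      (hn.of_injective (LinearMap.ker f).subtype Subtype.val_injective))
  obtain ⟨Y, hY, hXY⟩ := hX.isPredecessor_of_addClosure (fun _ h => h.1) this
  exact leftPart_of_isPredecessor hX hXY hY

/-! ### `mod_H` as an abelian exact subcategory of `mod_A` -/

variable (H M R) in
/-- The identification of `mod_H` with a full subcategory of `mod_A`. -/
noncomputable abbrev restrictH : RightMod H ⥤ RightMod (TriMatrix H M R) :=
  RightMod.restrict toH toH_surjective

theorem rPart_restrictH (Y : RightMod H) : rPart H M R ((restrictH H M R).obj Y) = ⊥ := by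
  rw [rPart_eq_bot_iff]
  intro x
  exact zero_smul Hᵐᵒᵖ (show Y from x)

/-- An `H`-module and its restriction to the matrix ring have the same submodules. -/
def submoduleRestrictH (Y : RightMod H) :
    Submodule Hᵐᵒᵖ Y ≃o Submodule (TriMatrix H M R)ᵐᵒᵖ ((restrictH H M R).obj Y) where
  toFun p :=
    { carrier := p.carrier
      zero_mem' := p.zero_mem
      add_mem' := p.add_mem
      smul_mem' := fun a _ hx => p.smul_mem (op a.unop.h) hx }
  invFun p :=
    { carrier := p.carrier
      zero_mem' := p.zero_mem
      add_mem' := p.add_mem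
      smul_mem' := fun h _ hx => p.smul_mem (op (ofH h.unop)) hx }
  left_inv _ := rfl
  right_inv _ := rfl
  map_rel_iff' := Iff.rfl

theorem isIndec_restrictH_iff (Y : RightMod H) :
    IsIndec ((restrictH H M R).obj Y) ↔ IsIndec Y := by
  let e := submoduleRestrictH (M := M) (R := R) Y
  refine and_congr Iff.rfl ⟨fun h p q hpq => ?_, fun h p q hpq => ?_⟩
  · exact (h _ _ (e.isCompl hpq)).imp (map_eq_bot_iff e).1 (map_eq_bot_iff e).1
  · exact (h _ _ (e.symm.isCompl hpq)).imp (map_eq_bot_iff e.symm).1 (map_eq_bot_iff e.symm).1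

theorem exists_restrictH_equiv (X : RightMod (TriMatrix H M R)) (hX : rPart H M R X = ⊥) :
    ∃ Y : RightMod H, Nonempty ((restrictH H M R).obj Y ≃ₗ[(TriMatrix H M R)ᵐᵒᵖ] X) := by
  have hX' := rPart_eq_bot_iff_hPart.1 hX
  obtain ⟨n, f, hf⟩ := exists_surjective_pi_H (X := X) hX
  have hmem : ∀ x : X, x ∈ hPart H M R X := fun x => hX' ▸ Submodule.mem_top
  let g : (Fin n → H) →ₗ[Hᵐᵒᵖ] hPart H M R X :=
    { toFun := fun y => ⟨f y, hmem _⟩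
      map_add' := fun y z => Subtype.ext (map_add f y z)
      map_smul' := fun h y => Subtype.ext (map_smul f (op (ofH h.unop : TriMatrix H M R)) y) }
  have : Module.Finite Hᵐᵒᵖ H := by
    refine ⟨⟨{1}, ?_⟩⟩
    rw [Submodule.eq_top_iff']
    intro x
    rw [Finset.coe_singleton, Submodule.mem_span_singleton]
    exact ⟨op x, by simp⟩
  have : Module.Finite Hᵐᵒᵖ (hPart H M R X) := Module.Finite.of_surjective g fun x => by
    obtain ⟨y, hy⟩ := hf x
    exact ⟨y, Subtype.ext hy⟩
  refine ⟨FGModuleCat.of Hᵐᵒᵖ (hPart H M R X), ⟨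
    { toFun := fun x => Subtype.val (p := fun x => x ∈ hPart H M R X) x
      invFun := fun x => (⟨x, hmem x⟩ : hPart H M R X)
      left_inv := fun _ => rfl
      right_inv := fun _ => rfl
      map_add' := fun _ _ => rfl
      map_smul' := fun a x => ?_ }⟩⟩
  exact congrArg Subtype.val (smul_hPart a.unop (show hPart H M R X from x)).symm

theorem indH_iff (X : RightMod (TriMatrix H M R)) :
    indH H M R X ↔ IsIndec X ∧ rPart H M R X = ⊥ := by
  constructor
  · rintro ⟨Y, hY, ⟨e⟩⟩
    have e' := FGModuleCat.isoToLinearEquiv e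
    exact ⟨((isIndec_restrictH_iff Y).2 hY).of_linearEquiv e',
      rPart_eq_bot_of_surjective e'.toLinearMap e'.surjective (rPart_restrictH Y)⟩
  · rintro ⟨hX, hX'⟩
    obtain ⟨Y, ⟨e⟩⟩ := exists_restrictH_equiv X hX'
    exact ⟨Y, (isIndec_restrictH_iff Y).1 (hX.of_linearEquiv e.symm),
      ⟨e.toFGModuleCatIso⟩⟩

theorem leftPart_eq_indH_iff : leftPart (TriMatrix H M R) = indH H M R ↔
    ∀ X : RightMod (TriMatrix H M R), leftPart (TriMatrix H M R) X ↔
      IsIndec X ∧ rPart H M R X = ⊥ := by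
  refine ⟨fun h X => by rw [h, indH_iff], fun h => ?_⟩
  ext X
  rw [h, indH_iff]

theorem addClosure_indH_iff [IsArtinianRing (TriMatrix H M R)ᵐᵒᵖ]
    (X : RightMod (TriMatrix H M R)) : addClosure (indH H M R) X ↔ rPart H M R X = ⊥ := by
  constructor
  · rintro ⟨n, Y, hY, Z, ⟨e⟩⟩
    refine rPart_eq_bot_of_injective (e.toLinearMap ∘ₗ LinearMap.inl _ X Z)
      (e.injective.comp LinearMap.inl_injective) ?_
    rw [rPart_eq_bot_iff]
    intro y
    ext i
    exact rPart_eq_bot_iff.1 ((indH_iff _).1 (hY i)).2 (y i)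
  · exact addClosure_of_decomposition (D := fun X => rPart H M R X = ⊥)
      (fun _ Y hX hY f hf => (indH_iff Y).2 ⟨hY, rPart_eq_bot_of_injective f hf hX⟩) X

instance : (restrictH H M R).Faithful where
  map_injective {X Y f g} h := by
    ext x
    exact LinearMap.congr_fun (f := ((restrictH H M R).map f).hom.hom)
      (congrArg (fun h => h.hom.hom) h) x

instance : (restrictH H M R).Full where
  map_surjective {X Y} f :=
    let φ : (restrictH H M R).obj X →ₗ[(TriMatrix H M R)ᵐᵒᵖ] (restrictH H M R).obj Y := f.hom.hom
    ⟨⟨ModuleCat.ofHom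
      { toFun := φ
        map_add' := φ.map_add
        map_smul' := fun h x => φ.map_smul (op (ofH h.unop : TriMatrix H M R)) x }⟩, rfl⟩

variable [IsNoetherianRing Hᵐᵒᵖ] [IsNoetherianRing (TriMatrix H M R)ᵐᵒᵖ]

instance : PreservesFiniteLimits (restrictH H M R) := by
  have : PreservesFiniteLimits
      (ModuleCat.restrictScalars.{u} (RingHom.op (toH : TriMatrix H M R →+* H))) :=
    ⟨fun _ _ _ => ⟨inferInstance⟩⟩
  have : PreservesFiniteLimits (restrictH H M R ⋙
      forget₂ (RightMod (TriMatrix H M R)) (ModuleCat (TriMatrix H M R)ᵐᵒᵖ)) :=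
    comp_preservesFiniteLimits (forget₂ (RightMod H) (ModuleCat.{u} Hᵐᵒᵖ))
      (ModuleCat.restrictScalars.{u} (RingHom.op (toH : TriMatrix H M R →+* H)))
  exact preservesFiniteLimits_of_reflects_of_preserves _
    (forget₂ (RightMod (TriMatrix H M R)) (ModuleCat (TriMatrix H M R)ᵐᵒᵖ))

instance : PreservesFiniteColimits (restrictH H M R) := by
  have : PreservesFiniteColimits (restrictH H M R ⋙
      forget₂ (RightMod (TriMatrix H M R)) (ModuleCat (TriMatrix H M R)ᵐᵒᵖ)) :=
    comp_preservesFiniteColimits (forget₂ (RightMod H) (ModuleCat.{u} Hᵐᵒᵖ))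
      (ModuleCat.restrictScalars.{u} (RingHom.op (toH : TriMatrix H M R →+* H)))
  exact preservesFiniteColimits_of_reflects_of_preserves _
    (forget₂ (RightMod (TriMatrix H M R)) (ModuleCat (TriMatrix H M R)ᵐᵒᵖ))

/-- The additive closure is the essential image of the fully faithful exact functor `restrictH`, so
the abelian structure and exactness transport from `mod_H`. -/
theorem isAbelianExact_addClosure_indH [IsArtinianRing (TriMatrix H M R)ᵐᵒᵖ] :
    IsAbelianExact (addClosure (indH H M R)) := by
  let G : RightMod H ⥤ (addClosure (indH H M R)).FullSubcategory :=
    (addClosure (indH H M R)).lift (restrictH H M R)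
      fun Y => (addClosure_indH_iff _).2 (rPart_restrictH Y)
  have : G.EssSurj := ⟨fun X => by
    obtain ⟨Y, ⟨e⟩⟩ := exists_restrictH_equiv X.obj ((addClosure_indH_iff _).1 X.property)
    exact ⟨Y, ⟨(addClosure (indH H M R)).isoMk e.toFGModuleCatIso⟩⟩⟩
  have : G.IsEquivalence := {}
  have : HasFiniteProducts (addClosure (indH H M R)).FullSubcategory :=
    ⟨fun n => Adjunction.hasLimitsOfShape_of_equivalence G.inv⟩
  let e : G.inv ⋙ restrictH H M R ≅ (addClosure (indH H M R)).ι :=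
    Functor.isoWhiskerRight G.asEquivalence.counitIso (addClosure (indH H M R)).ι
  refine ⟨⟨abelianOfEquivalence G.inv⟩, ?_, ?_⟩
  · exact preservesFiniteLimits_of_natIso e
  · exact preservesFiniteColimits_of_natIso e

end TriMatrix

/-! ### Finiteness over `k` and the equivalence -/

section Algebra

variable {k : Type*} {H M R : Type u} [CommRing k]
    [Ring H] [Algebra k H] [Ring R] [Algebra k R]
    [AddCommGroup M] [Module k M]
    [Module R M] [Module Hᵐᵒᵖ M] [SMulCommClass R Hᵐᵒᵖ M]
    [IsScalarTower k R M] [IsScalarTower k Hᵐᵒᵖ M]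

variable (k H M R) in
theorem TriMatrix.isArtinianRing_op [IsArtinianRing k] [Module.Finite k H] [Module.Finite k R]
    [Module.Finite k M] : IsArtinianRing (TriMatrix H M R)ᵐᵒᵖ := by
  let e : TriMatrix H M R ≃+ H × M × R :=
    { toFun := fun a => (a.h, a.m, a.r)
      invFun := fun a => ⟨a.1, a.2.1, a.2.2⟩
      left_inv := fun _ => rfl
      right_inv := fun _ => rfl
      map_add' := fun _ _ => rfl }
  let _ : Module k (TriMatrix H M R) := e.module k
  let e' : TriMatrix H M R ≃ₗ[k] H × M × R :=
    { e with map_smul' := fun c a => e.apply_symm_apply _ }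
  have hh : ∀ (c : k) (a : TriMatrix H M R), (c • a).h = c • a.h := fun _ _ => rfl
  have hm : ∀ (c : k) (a : TriMatrix H M R), (c • a).m = c • a.m := fun _ _ => rfl
  have hr : ∀ (c : k) (a : TriMatrix H M R), (c • a).r = c • a.r := fun _ _ => rfl
  have : Module.Finite k (TriMatrix H M R) := Module.Finite.equiv e'.symm
  have : IsScalarTower k (TriMatrix H M R)ᵐᵒᵖ (TriMatrix H M R)ᵐᵒᵖ := ⟨fun c x y => by
    apply unop_injective
    simp only [smul_eq_mul, unop_mul, unop_smul]
    ext
    · simp [hh]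
    · simp only [mul_m, hm, hh, op_smul, smul_assoc, smul_add]
      rw [smul_comm c (unop y).r]
    · simp [hr]⟩
  exact IsArtinianRing.of_finite k _

end Algebra

theorem mainTheorem4 {k : Type*} {H M R : Type u} [CommRing k] [IsArtinianRing k]
    [Ring H] [Algebra k H] [Module.Finite k H]
    [Ring R] [Algebra k R] [Module.Finite k R]
    [AddCommGroup M] [Module k M] [Module.Finite k M]
    [Module R M] [Module Hᵐᵒᵖ M] [SMulCommClass R Hᵐᵒᵖ M]
    [IsScalarTower k R M] [IsScalarTower k Hᵐᵒᵖ M]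
    (hH : IsHereditary H) [IsLocalRing R] (hR : ¬ ∀ r : R, r ≠ 0 → IsUnit r) :
    List.TFAE [
      IsAbelianExact (addClosure (leftPart (TriMatrix H M R))),
      leftPart (TriMatrix H M R) = indH H M R,
      Module.Injective Hᵐᵒᵖ M] := by
  have := TriMatrix.isArtinianRing_op k H M R
  have : IsArtinianRing R := IsArtinianRing.of_finite k R
  have : IsNoetherianRing Hᵐᵒᵖ := IsNoetherianRing.of_finite k Hᵐᵒᵖ
  have hle := TriMatrix.rPart_eq_bot_of_leftPart (H := H) (M := M) hR
  tfae_have 1 → 2 := fun h => TriMatrix.leftPart_eq_indH_iff.2 fun X =>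
    ⟨fun hX => ⟨hX.1, hle X hX⟩,
      fun hX => TriMatrix.leftPart_of_isAbelianExact hH h hX.1 hX.2⟩
  tfae_have 2 → 1 := fun h => h ▸ TriMatrix.isAbelianExact_addClosure_indH
  tfae_have 2 → 3 := fun h => TriMatrix.injective_of_rPartSplits
    (TriMatrix.rPartSplits_of_leftPart (TriMatrix.leftPart_eq_indH_iff.1 h))
  tfae_have 3 → 2 := fun h => TriMatrix.leftPart_eq_indH_iff.2 fun X =>
    ⟨fun hX => ⟨hX.1, hle X hX⟩, fun hX =>
      TriMatrix.leftPart_of_rPart_eq_bot hH (TriMatrix.rPartSplits_of_injective hH h) hX.1 hX.2⟩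
  tfae_finish
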